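/- **Theorem 1 (Moments of k-wise Independent Sums).** For a real random variable $Z$ write $\|Z\|_d=(\mathbb{E}|Z|^d)^{1/d}$. Call real random variables $X_1,\dots,X_n$ on a common probability space $k$-wise independent if every subfamily of at most $k$ of them is independent. There are absolute constants $0<c\le C$ such that the following holds. Let $n\ge 1$, $k\ge 2$ be integers, let $d\le k$ be a positive even integer, and let $0<\sigma^2\le 1$. Put $$M(n,\sigma^2,d)=\begin{cases}\sqrt{dn\sigma^2} & \text{if } \log\frac{d}{n\sigma^2}<\max\left(\frac dn,2\right),\\[2pt] \dfrac{d}{\log\frac{d}{n\sigma^2}} & \text{if } \max\left(\frac dn,2\right)\le\log\frac{d}{n\sigma^2}\le d,\\[2pt] (n\sigma^2)^{1/d} & \text{if } d<\log\frac{d}{n\sigma^2}.\end{cases}$$ Assume that $d\le 2n$ or $\log\frac{d}{n\sigma^2}\ge \frac dn$; this holds automatically if $k\le n$. Consider all families $(X_i)_{i=1}^n$, on arbitrary probability spaces, such that (a) $(X_i)_i$ are $k$-wise independent and $|X_i-\mathbb{E}X_i|\le 1$ almost surely for every $i$; (b) $\sum_{i=1}^n\mathbb{V}[X_i]\le n\sigma^2$.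 With $S=\sum_{i=1}^n X_i$, the maximum of $\|S-\mathbb{E}S\|_d$ over all families satisfying (a) and (b) exists and $$c\,M(n,\sigma^2,d)\;\le\;\max_{(X_i)}\|S-\mathbb{E}S\|_d\;\le\; C\,M(n,\sigma^2,d).$$ Moreover, if $\sigma^2\le\frac12$, the maximum is realized up to a constant when $X_i\sim B-B'$ with $B,B'$ i.i.d. $\mathrm{Bern}(p)$, $p=\frac12\left(1-\sqrt{1-2\sigma^2}\right)$: $k$-wise independent families with these marginals exist, each of them satisfies (a) and (b), and each has $\|S-\mathbb{E}S\|_d\ge c\cdot\max_{(X_i)}\|S-\mathbb{E}S\|_d$. -/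

import Mathlib

open MeasureTheory ProbabilityTheory

universe u

/-- `k`-wise independence: any at most `k` of the random variables `X i` are
(mutually) independent. -/
def KWiseIndep {Ω : Type u} [MeasurableSpace Ω] {n : ℕ} (k : ℕ) (X : Fin n → Ω → ℝ)
    (P : Measure Ω) : Prop :=
  ∀ s : Finset (Fin n), s.card ≤ k → iIndepFun (fun i : s => X i) P

/-- The `d`-th norm `‖Z‖_d = (E|Z|^d)^(1/d)` of a real random variable. -/
noncomputable def momentNorm {Ω : Type u} [MeasurableSpace Ω] (d : ℕ) (Z : Ω → ℝ)
    (P : Measure Ω) : ℝ :=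
  (∫ ω, |Z ω| ^ d ∂P) ^ (1 / (d : ℝ))

/-- The sum `S = ∑ X_i`. -/
def totalSum {Ω : Type u} {n : ℕ} (X : Fin n → Ω → ℝ) : Ω → ℝ :=
  fun ω => ∑ i, X i ω

/-- `‖S - E S‖_d` for `S = ∑ X_i`. -/
noncomputable def centeredNorm {Ω : Type u} [MeasurableSpace Ω] {n : ℕ} (d : ℕ)
    (X : Fin n → Ω → ℝ) (P : Measure Ω) : ℝ :=
  momentNorm d (fun ω => totalSum X ω - ∫ ω', totalSum X ω' ∂P) P

/-- The conditions on the family: `k`-wise independent random variables with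
`|X_i - E X_i| ≤ 1` almost surely and `∑ Var X_i ≤ n v` (here `v` is `σ²`).
On a probability space, the almost sure bound forces every `X_i` to be bounded almost surely,
hence integrable with finite variance, so all the integrals involved are genuine. -/
structure Admissible {Ω : Type u} [MeasurableSpace Ω] {n : ℕ} (k : ℕ) (v : ℝ)
    (X : Fin n → Ω → ℝ) (P : Measure Ω) : Prop where
  measurable : ∀ i, Measurable (X i)
  indep : KWiseIndep k X P
  bounded : ∀ i, ∀ᵐ ω ∂P, |X i ω - ∫ ω', X i ω' ∂P| ≤ 1
  variance_le : ∑ i, variance (X i) P ≤ n * v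

/-- All values `‖S - E S‖_d` taken over the admissible families, on all probability spaces. -/
def normValues (n k : ℕ) (v : ℝ) (d : ℕ) : Set ℝ :=
  {r | ∃ (Ω : Type u) (_ : MeasurableSpace Ω) (P : Measure Ω) (_ : IsProbabilityMeasure P)
    (X : Fin n → Ω → ℝ), Admissible k v X P ∧ centeredNorm d X P = r}

/-- The three-branch function `M(n, v, d)`, where `v` is `σ²`. -/
noncomputable def momentBound (n : ℕ) (v : ℝ) (d : ℕ) : ℝ :=
  if Real.log (d / (n * v)) < max ((d : ℝ) / n) 2 then √(d * n * v)
  else if Real.log (d / (n * v)) ≤ d then d / Real.log (d / (n * v))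
  else (n * v) ^ (1 / (d : ℝ))

/-- The law of `B - B'` with `B, B'` independent Bernoulli variables of parameter `p`. -/
noncomputable def bernoulliDiffLaw (p : unitInterval) : Measure ℝ :=
  ((bernoulliMeasure (1 : ℝ) 0 p).prod (bernoulliMeasure (1 : ℝ) 0 p)).map
    (fun b : ℝ × ℝ => b.1 - b.2)

/-!
The argument is carried by generating polynomials of moments. Expanding `(∑ Y i) ^ d` produces
monomials in at most `d ≤ k` of the variables, so `k`-wise independence is as good as independence
and `E[(∑ Y i) ^ d] = d! [X ^ d] ∏ i, ∑_{j ≤ d} E[(Y i) ^ j] X ^ j / j!` (`integral_sum_pow_eq`,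
`factorial_mul_coeff_prod_momentPoly`). Both inequalities compare such products coefficient by
coefficient (`Majorized`).

For the upper bound, the `j`-th central moments, `j ≥ 2`, are at most the variances, so the
product is majorized by `∏ (1 + Var (X i) (e ^ X - 1 - X))`; evaluating at `t > 0` gives
`E[(S - E S) ^ d] ≤ d! t ^ (-d) (exp (n σ² (e ^ t - 1 - t)) - 1)` (`abs_factorial_mul_coeff_le`).
With `L = log (d / (n σ²))`, the choices `t = √(d / (n σ²))`, `t = L`, `t = d` give the three
branches (`rpow_le_momentBound`).

For the lower bound, `B - B'` is the symmetric law on `{-1, 0, 1}` of variance `σ²`, whose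
polynomial is `1 + σ² (cosh X - 1)`, truncated. All coefficients of its `n`-th power are
nonnegative, and each branch keeps one part of the expansion: the pure powers
(`threePointSumMoment_ge_mul`), the products of `d / 2` distinct squares
(`threePointSumMoment_ge_choose`), or, splitting the variables into about `d / L` blocks, the
moments of a sum of about `d / L` random signs (`threePointSumMoment_ge_blocks`). The same law is
a probability measure for every `σ² ≤ 1`, which covers `σ² > 1 / 2` too.

The maximum is attained because the moments depend only on the laws of `X i - E X i`, which range
over a closed subset of the weakly compact space of `n`-tuples of probability measures on
`[-1, 1]` (`exists_isGreatest_normValues`).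
-/

/-! ### Generating polynomials of moments -/

section

open Polynomial

/-- The exponential generating polynomial `∑_{j ≤ d} m_j X^j / j!` of a moment sequence `m`,
truncated at degree `d`. -/
noncomputable def momentPoly (d : ℕ) (m : ℕ → ℝ) : ℝ[X] :=
  ∑ j ∈ Finset.range (d + 1), monomial j (m j / j.factorial)


theorem coeff_momentPoly (d : ℕ) (m : ℕ → ℝ) (j : ℕ) :
    (momentPoly d m).coeff j = if j ≤ d then m j / j.factorial else 0 := by
  simp [momentPoly, coeff_monomial]

/-- Multiplying exponential generating polynomials implements the multinomial theorem. -/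
theorem factorial_mul_coeff_prod_momentPoly {n : ℕ} (d : ℕ) (m : Fin n → ℕ → ℝ) :
    d.factorial * (∏ i, momentPoly d (m i)).coeff d =
      ∑ a ∈ Finset.piAntidiag Finset.univ d,
        (Nat.multinomial Finset.univ a : ℝ) * ∏ i, m i (a i) := by
  have hset : (Finset.piAntidiag Finset.univ d : Finset (Fin n → ℕ)) =
      {a ∈ Fintype.piFinset fun _ : Fin n => Finset.range (d + 1) | ∑ i, a i = d} := by
    ext a
    simp only [Finset.mem_piAntidiag, Finset.mem_univ, implies_true, and_true, Finset.mem_filter,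
      Fintype.mem_piFinset, Finset.mem_range, Nat.lt_succ_iff]
    exact ⟨fun h => ⟨fun i => h ▸ Finset.single_le_sum (fun _ _ => Nat.zero_le _)
      (Finset.mem_univ i), h⟩, fun h => h.2⟩
  have hmon (a : Fin n → ℕ) : ∏ i, (monomial (a i) (m i (a i) / (a i).factorial) : ℝ[X]) =
      monomial (∑ i, a i) (∏ i, m i (a i) / (a i).factorial) := by
    simp only [← C_mul_X_pow_eq_monomial, Finset.prod_mul_distrib, Finset.prod_pow_eq_pow_sum,
      map_prod]
  simp only [momentPoly]
  rw [Finset.prod_univ_sum]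
  simp only [hmon, finsetSum_coeff, coeff_monomial]
  rw [← Finset.sum_filter, ← hset, Finset.mul_sum]
  refine Finset.sum_congr rfl fun a ha => ?_
  have hs : ∑ i, a i = d := (Finset.mem_piAntidiag.1 ha).1
  have h := Nat.multinomial_spec Finset.univ a
  rw [hs] at h
  have h' : (∏ i, ((a i).factorial : ℝ)) * Nat.multinomial Finset.univ a = d.factorial := by
    exact_mod_cast h
  rw [Finset.prod_div_distrib, ← h']
  have : (∏ i, ((a i).factorial : ℝ)) ≠ 0 := by positivity
  field_simp

theorem factorial_mul_coeff_prod_momentPoly_pow {n : ℕ} (d : ℕ) (x : Fin n → ℝ) :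
    d.factorial * (∏ i, momentPoly d (fun j => x i ^ j)).coeff d = (∑ i, x i) ^ d := by
  rw [factorial_mul_coeff_prod_momentPoly, Finset.sum_pow_eq_sum_piAntidiag]

/-! ### Coefficientwise majorization -/

/-- `Majorized p q`: every coefficient of `p` is bounded in absolute value by the corresponding
coefficient of `q`. In particular `Majorized 0 q` says that `q` has nonnegative coefficients. -/
def Majorized (p q : ℝ[X]) : Prop := ∀ j, |p.coeff j| ≤ q.coeff j

namespace Majorized

variable {p q r s : ℝ[X]}

theorem coeff_nonneg (h : Majorized p q) (j : ℕ) : 0 ≤ q.coeff j := (abs_nonneg _).trans (h j)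

theorem coeff_le (h : Majorized p q) (j : ℕ) : p.coeff j ≤ q.coeff j := (le_abs_self _).trans (h j)

theorem trans (h : Majorized p q) (h' : Majorized q r) : Majorized p r := fun j =>
  (h j).trans (h'.coeff_le j)

theorem add (h : Majorized p q) (h' : Majorized r s) : Majorized (p + r) (q + s) := fun j => by
  simpa using (abs_add_le _ _).trans (add_le_add (h j) (h' j))

theorem mul (h : Majorized p q) (h' : Majorized r s) : Majorized (p * r) (q * s) := fun j => by
  rw [coeff_mul, coeff_mul]
  refine (Finset.abs_sum_le_sum_abs _ _).trans (Finset.sum_le_sum fun x _ => ?_)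
  rw [abs_mul]
  exact mul_le_mul (h _) (h' _) (abs_nonneg _) (h.coeff_nonneg _)

theorem one : Majorized 1 1 := fun j => by
  rw [coeff_one]; split_ifs <;> simp

theorem prod {ι : Type*} (t : Finset ι) {f g : ι → ℝ[X]} (h : ∀ i ∈ t, Majorized (f i) (g i)) :
    Majorized (∏ i ∈ t, f i) (∏ i ∈ t, g i) := by
  classical
  induction t using Finset.induction_on with
  | empty => simpa using one
  | insert a t ha ih =>
    rw [Finset.prod_insert ha, Finset.prod_insert ha]
    exact (h a (by simp)).mul (ih fun i hi => h i (by simp [hi]))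

theorem pow (h : Majorized p q) (k : ℕ) : Majorized (p ^ k) (q ^ k) := by
  simpa using prod (Finset.range k) (fun _ _ => h)

/-- Bernoulli's inequality, coefficientwise. -/
theorem one_add_natCast_mul (h : Majorized 0 q) (b : ℕ) :
    Majorized (1 + C (b : ℝ) * q) ((1 + q) ^ b) := by
  have hq : Majorized q q := fun j => (abs_of_nonneg (h.coeff_nonneg j)).le
  have hq1 : Majorized (1 + q) (1 + q) := one.add hq
  induction b with
  | zero => simpa using one
  | succ b ih =>
    rw [pow_succ]
    refine Majorized.trans ?_ (ih.mul hq1)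
    have e : (1 + C (b : ℝ) * q) * (1 + q) =
        (1 + C ((b + 1 : ℕ) : ℝ) * q) + C (b : ℝ) * (q * q) := by
      push_cast; rw [C_add, C_1]; ring
    rw [e]
    intro j
    have h1 : 0 ≤ (1 + C ((b + 1 : ℕ) : ℝ) * q).coeff j := by
      have := one.coeff_nonneg j
      have := h.coeff_nonneg j
      rw [coeff_add, coeff_C_mul]
      positivity
    rw [abs_of_nonneg h1, coeff_add _ (C (b : ℝ) * _), coeff_C_mul (q * q)]
    exact le_add_of_nonneg_right (mul_nonneg b.cast_nonneg ((hq.mul hq).coeff_nonneg j))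

theorem coeff_mul_pow_le_eval (h : Majorized p q) {d : ℕ} (hd : d ≠ 0) {t : ℝ} (ht : 0 ≤ t) :
    q.coeff 0 + q.coeff d * t ^ d ≤ q.eval t := by
  have hN : q.natDegree < max q.natDegree d + 1 := by omega
  rw [eval_eq_sum_range' hN]
  have := Finset.sum_le_sum_of_subset_of_nonneg (s := {0, d})
    (t := Finset.range (max q.natDegree d + 1)) (f := fun j => q.coeff j * t ^ j)
    (by intro x; simp only [Finset.mem_insert, Finset.mem_singleton, Finset.mem_range]; omega)
    (fun j _ _ => mul_nonneg (h.coeff_nonneg j) (by positivity))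
  rw [Finset.sum_pair hd.symm] at this
  simpa using this

end Majorized

/-- The `d`-th moment of a sum of independent centred variables with `j`-th moments bounded by
`v i` for `j ≥ 2` obeys the same exponential bound as in Bennett's inequality, because the
coefficients of the generating polynomial are at most those of
`∏ (1 + v i (e ^ t - 1 - t))`. Since the constant coefficient can be split off, the exponential
is diminished by `1`. -/
theorem abs_factorial_mul_coeff_le {n d : ℕ} (hd : d ≠ 0) {m : Fin n → ℕ → ℝ} {v : Fin n → ℝ}
    (h0 : ∀ i, m i 0 = 1) (h1 : ∀ i, m i 1 = 0) (hv : ∀ i, 0 ≤ v i)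
    (hm : ∀ i j, 2 ≤ j → |m i j| ≤ v i) {t V : ℝ} (ht : 0 < t) (hV : ∑ i, v i ≤ V) :
    |d.factorial * (∏ i, momentPoly d (m i)).coeff d| ≤
      d.factorial / t ^ d * (Real.exp (V * (Real.exp t - 1 - t)) - 1) := by
  set Φ : ℝ[X] := momentPoly d (fun j => if 2 ≤ j then 1 else 0) with hΦ
  have hΦc (j : ℕ) : 0 ≤ Φ.coeff j := by
    rw [hΦ, coeff_momentPoly]
    split_ifs <;> positivity
  have hmaj : Majorized (∏ i, momentPoly d (m i)) (∏ i, (1 + C (v i) * Φ)) := by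
    refine Majorized.prod _ fun i _ j => ?_
    rw [coeff_add, coeff_C_mul, hΦ, coeff_momentPoly, coeff_momentPoly, coeff_one]
    rcases Nat.lt_or_ge j 2 with hj | hj
    · interval_cases j
      · simp [h0]
      · simp [h1]
    · have : j ≠ 0 := by omega
      by_cases hjd : j ≤ d
      · simp only [hjd, hj, if_true, this, if_false, zero_add, abs_div, Nat.abs_cast, mul_one_div]
        gcongr
        exact hm i j hj
      · simp [hjd, this]
  have hΦe : Φ.eval t ≤ Real.exp t - 1 - t := by
    have h := Real.sum_le_exp_of_nonneg ht.le (d + 2)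
    rw [Finset.sum_range_succ', Finset.sum_range_succ'] at h
    have h2 : Φ.eval t ≤ ∑ k ∈ Finset.range d, t ^ (k + 1 + 1) / ((k + 1 + 1).factorial : ℝ) := by
      rw [hΦ, momentPoly, eval_finsetSum]
      obtain ⟨e, rfl⟩ := Nat.exists_eq_succ_of_ne_zero hd
      rw [Nat.succ_eq_add_one, Finset.sum_range_succ', Finset.sum_range_succ',
        Finset.sum_range_succ]
      simp only [eval_monomial]
      norm_num
      rw [← add_zero (∑ x ∈ _, _)]
      refine add_le_add (Finset.sum_le_sum fun k _ => ?_) (by positivity)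
      exact le_of_eq (by ring)
    norm_num at h h2
    linarith
  have h := hmaj.coeff_mul_pow_le_eval hd ht.le
  have hc0 : (∏ i, (1 + C (v i) * Φ)).coeff 0 = 1 := by
    rw [coeff_zero_eq_eval_zero, eval_prod]
    refine Finset.prod_eq_one fun i _ => ?_
    have : Φ.eval 0 = 0 := by rw [← coeff_zero_eq_eval_zero, hΦ, coeff_momentPoly]; simp
    simp [this]
  have hexp : (∏ i, (1 + C (v i) * Φ)).eval t ≤ Real.exp (V * (Real.exp t - 1 - t)) := by
    have hφ : 0 ≤ Real.exp t - 1 - t := by linarith [Real.add_one_le_exp t]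
    calc (∏ i, (1 + C (v i) * Φ)).eval t = ∏ i, (1 + v i * Φ.eval t) := by simp [eval_prod]
      _ ≤ ∏ i, Real.exp (v i * (Real.exp t - 1 - t)) := by
          refine Finset.prod_le_prod (fun i _ => ?_) fun i _ => ?_
          · have : 0 ≤ Φ.eval t := by
              rw [eval_eq_sum_range]
              exact Finset.sum_nonneg fun j _ => mul_nonneg (hΦc j) (by positivity)
            have := hv i
            positivity
          · have := Real.add_one_le_exp (v i * (Real.exp t - 1 - t))
            have := mul_le_mul_of_nonneg_left hΦe (hv i)
            linarith
      _ = Real.exp ((∑ i, v i) * (Real.exp t - 1 - t)) := by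
          rw [← Real.exp_sum, Finset.sum_mul]
      _ ≤ _ := by gcongr
  rw [abs_mul, Nat.abs_cast, div_mul_eq_mul_div, mul_div_assoc]
  gcongr
  rw [le_div_iff₀ (by positivity)]
  calc _ ≤ (∏ i, (1 + C (v i) * Φ)).coeff d * t ^ d := by gcongr; exact hmaj d
    _ ≤ _ := by linarith

/-! ### Moments of symmetric three-point variables -/

/-- The moments of the symmetric law on `{-1, 0, 1}` of variance `v`. -/
noncomputable def threePointMoment (v : ℝ) (j : ℕ) : ℝ :=
  if j = 0 then 1 else if Even j then v else 0

theorem momentPoly_threePoint_eq (d : ℕ) (v : ℝ) :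
    momentPoly d (threePointMoment v) = 1 + C v * (momentPoly d (threePointMoment 1) - 1) := by
  ext j
  simp only [coeff_add, coeff_C_mul, coeff_sub, coeff_momentPoly, coeff_one, threePointMoment]
  rcases eq_or_ne j 0 with rfl | hj
  · simp
  · simp only [hj, if_false]
    split_ifs <;> simp [div_eq_mul_inv]

theorem majorized_zero_cosh (d : ℕ) {v : ℝ} (hv : 0 ≤ v) :
    Majorized 0 (C v * (momentPoly d (threePointMoment 1) - 1)) := by
  intro j
  simp only [coeff_C_mul, coeff_sub, coeff_momentPoly, coeff_one, threePointMoment, coeff_zero,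
    abs_zero]
  rcases eq_or_ne j 0 with rfl | hj
  · simp
  · simp only [hj, if_false]
    split_ifs <;> (simp; try positivity)

/-- The moment of the sum of `m` random signs is at least its contribution from the event that
all the signs are positive. -/
theorem sign_sum_moment_ge {d : ℕ} (hd : Even d) (m : ℕ) :
    (m : ℝ) ^ d / 2 ^ m ≤
      d.factorial * (momentPoly d (threePointMoment 1) ^ m).coeff d := by
  have hsplit : momentPoly d (threePointMoment 1) =
      C (1 / 2 : ℝ) * ∑ x ∈ ({1, -1} : Finset ℝ), momentPoly d (fun j => x ^ j) := by
    rw [Finset.sum_pair (by norm_num)]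
    ext j
    simp only [coeff_C_mul, coeff_add, coeff_momentPoly, threePointMoment, one_pow]
    rcases eq_or_ne j 0 with rfl | hj
    · norm_num
    · rcases Nat.even_or_odd j with hj' | hj'
      · simp only [hj, hj', if_true, if_false, hj'.neg_one_pow]
        split_ifs <;> ring
      · simp only [hj, Nat.not_even_iff_odd.2 hj', if_false, hj'.neg_one_pow]
        split_ifs <;> ring
  have hpow : momentPoly d (threePointMoment 1) ^ m =
      C ((1 / 2 : ℝ) ^ m) * ∑ x ∈ Fintype.piFinset fun _ : Fin m => ({1, -1} : Finset ℝ),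
        ∏ i, momentPoly d (fun j => x i ^ j) := by
    rw [hsplit, mul_pow, ← C_pow,
      ← Finset.prod_univ_sum (fun _ : Fin m => ({1, -1} : Finset ℝ))
        (fun _ x => momentPoly d (fun j => x ^ j)), Finset.prod_const, Finset.card_fin]
  rw [hpow, coeff_C_mul, finsetSum_coeff, mul_left_comm, Finset.mul_sum]
  simp only [factorial_mul_coeff_prod_momentPoly_pow]
  have h1 : (m : ℝ) ^ d ≤ ∑ x ∈ Fintype.piFinset fun _ : Fin m => ({1, -1} : Finset ℝ),
      (∑ i, x i) ^ d := by
    have := Finset.single_le_sum (f := fun x : Fin m → ℝ => (∑ i, x i) ^ d)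
      (s := Fintype.piFinset fun _ : Fin m => ({1, -1} : Finset ℝ))
      (fun x _ => hd.pow_nonneg _) (a := fun _ => 1) (by simp)
    simpa using this
  rw [div_eq_inv_mul, one_div, inv_pow]
  gcongr

/-- The `d`-th moment of the sum of `n` independent copies of the symmetric law on `{-1, 0, 1}`
of variance `v`. -/
noncomputable def threePointSumMoment (n : ℕ) (v : ℝ) (d : ℕ) : ℝ :=
  d.factorial * (momentPoly d (threePointMoment v) ^ n).coeff d

/-- Contribution of the indices occurring `d` times. -/
theorem threePointSumMoment_ge_mul (n : ℕ) {v : ℝ} (hv : 0 ≤ v) {d : ℕ} (hd : Even d)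
    (hd0 : d ≠ 0) : n * v ≤ threePointSumMoment n v d := by
  have h := ((majorized_zero_cosh d hv).one_add_natCast_mul n).coeff_le d
  rw [← momentPoly_threePoint_eq] at h
  simp only [coeff_add, coeff_C_mul, coeff_sub, coeff_momentPoly, coeff_one,
    threePointMoment, hd0, hd, le_refl, if_true, if_false] at h
  rw [threePointSumMoment]
  refine le_trans (le_of_eq ?_) (mul_le_mul_of_nonneg_left h (by positivity))
  field_simp
  ring

/-- Contribution of the patterns in which `h` of the variables occur twice each. -/
theorem threePointSumMoment_ge_choose (n : ℕ) {v : ℝ} (hv : 0 ≤ v) {h : ℕ} (hh : h ≠ 0) :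
    ((2 * h).factorial : ℝ) * (n.choose h * (v / 2) ^ h) ≤ threePointSumMoment n v (2 * h) := by
  have hm : Majorized (1 + C (v / 2) * X ^ 2) (momentPoly (2 * h) (threePointMoment v)) := by
    intro j
    simp only [coeff_add, coeff_C_mul, coeff_X_pow, coeff_momentPoly, coeff_one, threePointMoment]
    rcases eq_or_ne j 0 with rfl | hj
    · simp
    rcases eq_or_ne j 2 with rfl | hj2
    · have : 2 ≤ 2 * h := by omega
      simpa [this] using (abs_of_nonneg (by positivity : 0 ≤ v / 2)).le
    · simp only [hj, hj2, if_false]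
      split_ifs <;> (simp; try positivity)
  have hc := (hm.pow n).coeff_le (2 * h)
  have e : ((1 + C (v / 2) * X ^ 2 : ℝ[X]) ^ n).coeff (2 * h) = n.choose h * (v / 2) ^ h := by
    rw [add_comm, add_pow, finsetSum_coeff]
    have (k : ℕ) : ((C (v / 2) * X ^ 2 : ℝ[X]) ^ k * 1 ^ (n - k) * (n.choose k : ℝ[X])).coeff
        (2 * h) = if k = h then n.choose h * (v / 2) ^ h else 0 := by
      rw [one_pow, mul_one, mul_pow, ← pow_mul, ← C_pow, ← C_eq_natCast, mul_comm, ← mul_assoc,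
        ← C_mul, coeff_C_mul, coeff_X_pow]
      split_ifs
      all_goals first | omega | simp_all
    simp only [this, Finset.sum_ite_eq', Finset.mem_range]
    split_ifs with hlt
    · rfl
    · rw [Nat.choose_eq_zero_of_lt (by omega)]; simp
  rw [e] at hc
  exact mul_le_mul_of_nonneg_left hc (by positivity)

/-- When the `n` variables are split into `m` blocks of length at least `n / m`, each block sum
has all its even moments at least `w`, hence at least `w` times those of a random sign. -/
theorem threePointSumMoment_ge_blocks (n : ℕ) {v : ℝ} (hv : 0 ≤ v) {d : ℕ} (hd : Even d)
    (m : ℕ) {w : ℝ} (hw0 : 0 ≤ w) (hw1 : w ≤ 1) (hw : w ≤ (n / m : ℕ) * v) :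
    w ^ m * ((m : ℝ) ^ d / 2 ^ m) ≤ threePointSumMoment n v d := by
  set Q := momentPoly d (threePointMoment 1) with hQ
  have hP := momentPoly_threePoint_eq d v
  have h0 := majorized_zero_cosh d hv
  have hone : Majorized 1 (momentPoly d (threePointMoment v)) := by
    rw [hP]
    simpa using Majorized.one.add h0
  have hblock : Majorized (C w * Q) (momentPoly d (threePointMoment v) ^ (n / m)) := by
    rw [hP]
    refine Majorized.trans (fun j => ?_) (h0.one_add_natCast_mul _)
    simp only [coeff_add, coeff_C_mul, coeff_sub, hQ, coeff_momentPoly, coeff_one,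
      threePointMoment]
    rcases eq_or_ne j 0 with rfl | hj
    · simpa [abs_of_nonneg hw0] using hw1
    · simp only [hj, if_false]
      split_ifs
      · rw [abs_of_nonneg (by positivity)]
        simp only [sub_zero, zero_add, ← mul_assoc]
        gcongr
      all_goals simp
  have hall : Majorized ((C w * Q) ^ m) (momentPoly d (threePointMoment v) ^ n) := by
    have e := Nat.div_add_mod n m
    have := (hblock.pow m).mul (hone.pow (n % m))
    rwa [one_pow, mul_one, ← pow_mul, ← pow_add, mul_comm (n / m), e] at this
  have hc := hall.coeff_le d
  rw [mul_pow, ← C_pow, coeff_C_mul] at hc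
  rw [threePointSumMoment]
  calc w ^ m * ((m : ℝ) ^ d / 2 ^ m) ≤ w ^ m * (d.factorial * (Q ^ m).coeff d) := by
        gcongr; exact sign_sum_moment_ge hd m
    _ = d.factorial * (w ^ m * (Q ^ m).coeff d) := by ring
    _ ≤ _ := by gcongr

end

/-! ### Comparison with the three-branch bound -/

theorem pow_le_pow_mul_choose {n h : ℕ} (hn : h ≤ n) : n ^ h ≤ h ^ h * n.choose h := by
  have key : n ^ h * h.factorial ≤ h ^ h * n.descFactorial h := by
    rw [← Nat.descFactorial_self, Nat.descFactorial_eq_prod_range, Nat.descFactorial_eq_prod_range,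
      ← Finset.card_range h, ← Finset.prod_const, ← Finset.prod_const, Finset.card_range,
      ← Finset.prod_mul_distrib, ← Finset.prod_mul_distrib]
    refine Finset.prod_le_prod' fun i hi => ?_
    rw [Nat.mul_sub, Nat.mul_sub, mul_comm n h]
    exact Nat.sub_le_sub_left (Nat.mul_le_mul_right i hn) _
  rw [Nat.descFactorial_eq_factorial_mul_choose, mul_left_comm, mul_comm] at key
  exact Nat.le_of_mul_le_mul_left key h.factorial_pos

theorem exp_sub_one_sub_le {t : ℝ} (ht : 0 ≤ t) :
    Real.exp t - 1 - t ≤ t ^ 2 * Real.exp t := by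
  have h1 : Real.exp t - 1 ≤ t * Real.exp t := by
    have := mul_le_mul_of_nonneg_right (Real.add_one_le_exp (-t)) (Real.exp_pos t).le
    rw [← Real.exp_add, neg_add_cancel, Real.exp_zero] at this
    linarith
  nlinarith

theorem rpow_one_div_le {A B : ℝ} {d : ℕ} (hd : d ≠ 0) (hA : 0 ≤ A) (hB : 0 ≤ B)
    (h : A ≤ B ^ d) : A ^ (1 / (d : ℝ)) ≤ B := by
  rw [one_div, ← Real.pow_rpow_inv_natCast hB hd]
  gcongr

theorem le_rpow_one_div {A B : ℝ} {d : ℕ} (hd : d ≠ 0) (hB : 0 ≤ B)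
    (h : B ^ d ≤ A) : B ≤ A ^ (1 / (d : ℝ)) := by
  rw [one_div, ← Real.pow_rpow_inv_natCast hB hd]
  gcongr

theorem rpow_one_div_pow {A : ℝ} {d : ℕ} (hd : d ≠ 0) (hA : 0 ≤ A) :
    (A ^ (1 / (d : ℝ))) ^ d = A := by
  rw [one_div, Real.rpow_inv_natCast_pow hA hd]

theorem momentBound_nonneg (n : ℕ) {v : ℝ} (hv : 0 ≤ v) (d : ℕ) : 0 ≤ momentBound n v d := by
  rw [momentBound]
  split_ifs with h1 h2
  · positivity
  · have : 2 ≤ Real.log (d / (n * v)) := (le_max_right _ _).trans (not_lt.1 h1)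
    positivity
  · positivity

theorem factorial_div_pow_le (d : ℕ) {t : ℝ} (ht : 0 < t) :
    (d.factorial : ℝ) / t ^ d ≤ (d / t) ^ d := by
  rw [div_pow]
  gcongr
  exact_mod_cast d.factorial_le_pow

/-- Optimizing the exponential bound over `t`: with `L = log (d / (n v))`, the choices are
`t = √(d / (n v))`, `t = L` and `t = d` in the three ranges. -/
theorem rpow_le_momentBound {n d : ℕ} (hn : 0 < n) (hd : d ≠ 0) {v : ℝ} (hv : 0 < v)
    (hnd : (d : ℝ) ≤ 2 * n ∨ (d : ℝ) / n ≤ Real.log (d / (n * v))) {A : ℝ} (hA : 0 ≤ A)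
    (hbound : ∀ t > 0, A ≤ d.factorial / t ^ d * (Real.exp (n * v * (Real.exp t - 1 - t)) - 1)) :
    A ^ (1 / (d : ℝ)) ≤ Real.exp 21 * momentBound n v d := by
  have hM := momentBound_nonneg n hv.le d
  refine rpow_one_div_le hd hA (by positivity) ?_
  have hnR : (0 : ℝ) < n := by exact_mod_cast hn
  have hdR : (0 : ℝ) < d := by positivity
  set V : ℝ := n * v with hVdef
  have hV : 0 < V := by positivity
  have hL : V * Real.exp (Real.log (d / V)) = d := by
    rw [Real.exp_log (by positivity)]; field_simp
  -- any `t` keeping the exponent below a multiple of `d` yields a bound of order `d / t`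
  have hexpL {t K : ℝ} (ht : 0 < t) (hK : V * (Real.exp t - 1 - t) ≤ K * d) :
      A ≤ (Real.exp K * (d / t)) ^ d := by
    calc A ≤ d.factorial / t ^ d * (Real.exp (V * (Real.exp t - 1 - t)) - 1) := hbound t ht
      _ ≤ (d / t) ^ d * Real.exp (K * d) := by
          have : 1 ≤ Real.exp (V * (Real.exp t - 1 - t)) :=
            Real.one_le_exp (mul_nonneg hV.le (by linarith [Real.add_one_le_exp t]))
          refine mul_le_mul (factorial_div_pow_le d ht) ?_ (by linarith) (by positivity)
          have := Real.exp_le_exp.2 hK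
          linarith
      _ = _ := by rw [mul_comm K, Real.exp_nat_mul, mul_pow, mul_comm]
  rw [momentBound, ← hVdef]
  split_ifs with h1 h2
  · have h2 : Real.log (d / V) < 2 := by
      rcases lt_max_iff.1 h1 with h | h
      · rcases hnd with h' | h'
        · refine h.trans_le ?_
          rwa [div_le_iff₀ hnR]
        · exact absurd h (not_lt.2 h')
      · exact h
    set t := √(d / V) with ht
    have ht0 : 0 < t := by positivity
    have ht2 : t ^ 2 = d / V := Real.sq_sqrt (by positivity)
    -- `d / V < e ^ 2` gives `t < 3`, and `e ^ 3 ≤ 21` is where the constant comes from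
    have ht3 : t ≤ 3 := by
      have h3 : d / V < Real.exp 2 := (Real.log_lt_iff_lt_exp (by positivity)).1 h2
      have h4 : Real.exp 2 < 9 := by
        rw [show (2 : ℝ) = 1 + 1 by norm_num, Real.exp_add]
        nlinarith [Real.exp_one_lt_d9, Real.exp_pos 1]
      nlinarith
    have he : Real.exp t ≤ 21 := by
      refine (Real.exp_le_exp.2 ht3).trans ?_
      rw [show (3 : ℝ) = (3 : ℕ) * 1 by norm_num, Real.exp_nat_mul]
      refine (pow_le_pow_left₀ (Real.exp_pos 1).le Real.exp_one_lt_d9.le 3).trans ?_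
      norm_num
    have e : √(d * n * v) = d / t := by
      rw [ht, mul_assoc, ← hVdef, eq_div_iff (by positivity), ← Real.sqrt_mul (by positivity),
        show (d : ℝ) * V * (d / V) = d ^ 2 by field_simp, Real.sqrt_sq hdR.le]
    rw [e]
    refine hexpL ht0 ?_
    calc V * (Real.exp t - 1 - t) ≤ V * (t ^ 2 * Real.exp t) := by
          gcongr; exact exp_sub_one_sub_le ht0.le
      _ = Real.exp t * d := by rw [ht2]; field_simp
      _ ≤ 21 * d := by gcongr
  · have hL2 : 2 ≤ Real.log (d / V) := (le_max_right _ _).trans (not_lt.1 h1)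
    refine (hexpL (K := 1) (t := Real.log (d / V)) (by linarith) ?_).trans ?_
    · rw [one_mul]
      calc _ ≤ V * Real.exp (Real.log (d / V)) := by gcongr; linarith
        _ = d := hL
        _ ≤ d := le_rfl
    · gcongr; norm_num
  -- here `y ≤ d`, and `e ^ y - 1 ≤ y e ^ y` retains the small factor `V`
  · have h3 : V * Real.exp d ≤ d := by
      rw [← hL]
      gcongr
      rw [hL]; linarith
    set y := V * (Real.exp d - 1 - d) with hy
    have hy0 : 0 ≤ y := mul_nonneg hV.le (by linarith [Real.add_one_le_exp (d : ℝ)])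
    have hy1 : y ≤ V * Real.exp d := by rw [hy]; gcongr; linarith
    have hy2 : Real.exp y - 1 ≤ y * Real.exp y := by
      have := mul_le_mul_of_nonneg_right (Real.add_one_le_exp (-y)) (Real.exp_pos y).le
      rw [← Real.exp_add, neg_add_cancel, Real.exp_zero] at this
      linarith
    rw [mul_pow, rpow_one_div_pow hd hV.le, ← Real.exp_nat_mul]
    have hf : (d.factorial : ℝ) / d ^ d ≤ 1 := by
      rw [div_le_one (by positivity)]
      exact_mod_cast d.factorial_le_pow
    calc A ≤ d.factorial / (d : ℝ) ^ d * (Real.exp y - 1) := hbound d hdR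
      _ ≤ 1 * (Real.exp y - 1) := by
          gcongr
          linarith [Real.one_le_exp hy0]
      _ ≤ (V * Real.exp d) * Real.exp d := by
          rw [one_mul]
          refine hy2.trans (mul_le_mul hy1 (Real.exp_le_exp.2 (hy1.trans h3)) ?_ ?_) <;> positivity
      _ = Real.exp (d * 2) * V := by rw [mul_two, Real.exp_add]; ring
      _ ≤ _ := by gcongr; norm_num

/-- The three-point family has a moment of order `M`. In the range where `M = d / L`, about `d / L`
blocks are used, each contributing a random sign with weight `exp (-L)`; the total weight
`exp (-d)` costs only a constant factor in the norm. -/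
theorem momentBound_le_rpow {n d : ℕ} (hn : 0 < n) (hd0 : d ≠ 0) (hd : Even d) {v : ℝ}
    (hv : 0 < v)
    (hnd : (d : ℝ) ≤ 2 * n ∨ (d : ℝ) / n ≤ Real.log (d / (n * v))) :
    Real.exp (-1) / 4 * momentBound n v d ≤ threePointSumMoment n v d ^ (1 / (d : ℝ)) := by
  have hM := momentBound_nonneg n hv.le d
  refine le_rpow_one_div hd0 (by positivity) ?_
  have hnR : (0 : ℝ) < n := by exact_mod_cast hn
  have hdR : (0 : ℝ) < d := by positivity
  set V : ℝ := n * v with hVdef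
  have hV : 0 < V := by positivity
  have hK : Real.exp (-1) / 4 ≤ Real.exp (-1) := by linarith [Real.exp_pos (-1)]
  rw [momentBound, ← hVdef]
  split_ifs with h1 h2
  · have hdn : (d : ℝ) ≤ 2 * n := by
      rcases hnd with h | h
      · exact h
      · rcases lt_max_iff.1 h1 with h' | h'
        · exact absurd h' (not_lt.2 h)
        · have := h.trans_lt h'
          rw [div_lt_iff₀ hnR] at this
          exact this.le
    obtain ⟨h, rfl⟩ := even_iff_exists_two_mul.1 hd
    have hh : h ≠ 0 := by rintro rfl; simp at hd0
    have hhn : h ≤ n := by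
      push_cast at hdn
      exact_mod_cast (by linarith : (h : ℝ) ≤ n)
    refine le_trans ?_ (threePointSumMoment_ge_choose n hv.le hh)
    have hfac : ((2 * h : ℕ) : ℝ) ^ (2 * h) ≤ Real.exp ((2 * h : ℕ) : ℝ) * (2 * h).factorial := by
      have := Real.pow_div_factorial_le_exp ((2 * h : ℕ) : ℝ) (by positivity) (2 * h)
      rwa [div_le_iff₀ (by positivity)] at this
    have hch : (n : ℝ) ^ h ≤ h ^ h * n.choose h := by exact_mod_cast pow_le_pow_mul_choose hhn
    have hhR : (0 : ℝ) < h := by positivity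
    calc (Real.exp (-1) / 4 * √(((2 * h : ℕ) : ℝ) * n * v)) ^ (2 * h)
        ≤ (Real.exp (-1) * √(((2 * h : ℕ) : ℝ) * n * v)) ^ (2 * h) := by gcongr
      _ = Real.exp (-((2 * h : ℕ) : ℝ)) * (((2 * h : ℕ) : ℝ) * n * v) ^ h := by
          rw [mul_pow, pow_mul (√_), Real.sq_sqrt (by positivity), ← Real.exp_nat_mul]
          simp
      _ = Real.exp (-((2 * h : ℕ) : ℝ)) * ((2 * h : ℕ) : ℝ) ^ (2 * h) / h ^ h * n ^ h
            * (v / 2) ^ h := by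
          have : (((2 * h : ℕ) : ℝ) * n * v) ^ h =
              ((2 * h : ℕ) : ℝ) ^ (2 * h) / h ^ h * n ^ h * (v / 2) ^ h := by
            rw [pow_mul, ← div_pow, ← mul_pow, ← mul_pow]
            congr 1
            push_cast
            field_simp
          rw [this]; ring
      _ ≤ Real.exp (-((2 * h : ℕ) : ℝ)) * (Real.exp ((2 * h : ℕ) : ℝ) * (2 * h).factorial) / h ^ h
            * (h ^ h * n.choose h) * (v / 2) ^ h := by gcongr
      _ = _ := by
          rw [← mul_assoc (Real.exp _), ← Real.exp_add, neg_add_cancel, Real.exp_zero]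
          field_simp
  · set L := Real.log (d / V) with hLdef
    have hL2 : 2 ≤ L := (le_max_right _ _).trans (not_lt.1 h1)
    have hLn : (d : ℝ) / n ≤ L := (le_max_left _ _).trans (not_lt.1 h1)
    have hL0 : 0 < L := by linarith
    have hLV : V * Real.exp L = d := by
      rw [hLdef, Real.exp_log (by positivity)]; field_simp
    set m := ⌊(d : ℝ) / L⌋₊ with hm
    have hdL : 1 ≤ (d : ℝ) / L := by rwa [le_div_iff₀ hL0, one_mul]
    have hm1 : 1 ≤ m := Nat.one_le_floor_iff _ |>.2 hdL
    have hmR : (1 : ℝ) ≤ m := by exact_mod_cast hm1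
    have hmle : (m : ℝ) ≤ d / L := Nat.floor_le (by positivity)
    have hmge : (d : ℝ) / L / 2 ≤ m := by
      have := Nat.lt_floor_add_one ((d : ℝ) / L)
      rw [← hm] at this
      linarith
    have hmL : (m : ℝ) * L ≤ d := by rwa [le_div_iff₀ hL0] at hmle
    have hmn : m ≤ n := by
      have : (d : ℝ) / L ≤ n := by
        rw [div_le_iff₀ hnR] at hLn
        rw [div_le_iff₀ hL0]; linarith
      exact_mod_cast hmle.trans this
    have hmd : m ≤ d := by
      have : (m : ℝ) ≤ d := by nlinarith
      exact_mod_cast this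
    -- the block length `n / m` loses at most a factor `2` against the real quotient
    have hb : (n : ℝ) ≤ 2 * m * (n / m : ℕ) := by
      have h3 : 1 ≤ n / m := Nat.div_pos hmn hm1
      have h4 := Nat.div_add_mod n m
      have h5 := Nat.mod_lt n hm1
      have : n ≤ 2 * m * (n / m) := by nlinarith
      exact_mod_cast this
    have hw : Real.exp (-L) ≤ (n / m : ℕ) * v := by
      have h3 : Real.exp (-L) * d = V := by
        rw [← hLV, mul_left_comm, ← Real.exp_add, neg_add_cancel, Real.exp_zero, mul_one]
      have h4 : V ≤ 2 * m * ((n / m : ℕ) * v) := by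
        rw [hVdef, ← mul_assoc]; gcongr
      have h5 : Real.exp (-L) * (2 * m) ≤ V := by
        rw [← h3]
        gcongr
        nlinarith
      have h6 : (2 * m : ℝ) * Real.exp (-L) ≤ 2 * m * ((n / m : ℕ) * v) := by linarith
      exact le_of_mul_le_mul_left h6 (by positivity)
    refine le_trans ?_ (threePointSumMoment_ge_blocks n hv.le hd m (Real.exp_pos _).le
      (Real.exp_le_one_iff.2 (by linarith)) hw)
    calc (Real.exp (-1) / 4 * (d / L)) ^ d ≤ (Real.exp (-1) * (m / 2)) ^ d := by
          refine pow_le_pow_left₀ (by positivity) ?_ d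
          nlinarith [Real.exp_pos (-1)]
      _ = Real.exp (-d) * (m ^ d / 2 ^ d) := by
          rw [mul_pow, div_pow, ← Real.exp_nat_mul]; simp
      _ ≤ Real.exp (-L) ^ m * (m ^ d / 2 ^ m) := by
          rw [← Real.exp_nat_mul]
          gcongr
          · linarith
          · norm_num
  · refine le_trans ?_ (threePointSumMoment_ge_mul n hv.le hd hd0)
    rw [mul_pow, rpow_one_div_pow hd0 hV.le]
    refine mul_le_of_le_one_left hV.le (pow_le_one₀ (by positivity) ?_)
    have := Real.exp_le_one_iff.2 (by norm_num : (-1 : ℝ) ≤ 0)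
    linarith

/-! ### Moments of `k`-wise independent sums -/

/-- A moment of order `d ≤ k` of a sum of `k`-wise independent variables is the same as for
fully independent ones: each monomial in its expansion involves at most `d` of the variables. -/
theorem integral_sum_pow_eq {Ω : Type*} [MeasurableSpace Ω] {P : Measure Ω}
    [IsProbabilityMeasure P] {n k d : ℕ} (hdk : d ≤ k) {Y : Fin n → Ω → ℝ}
    (hY : ∀ i, Measurable (Y i)) (hb : ∀ i, ∀ᵐ ω ∂P, |Y i ω| ≤ 1) (h : KWiseIndep k Y P) :
    ∫ ω, (∑ i, Y i ω) ^ d ∂P =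
      d.factorial * (∏ i, momentPoly d (fun j => ∫ ω, Y i ω ^ j ∂P)).coeff d := by
  rw [factorial_mul_coeff_prod_momentPoly]
  simp_rw [Finset.sum_pow_eq_sum_piAntidiag]
  rw [integral_finsetSum]
  · refine Finset.sum_congr rfl fun a ha => ?_
    rw [integral_const_mul]
    congr 1
    set s : Finset (Fin n) := {i | a i ≠ 0} with hs
    have hcard : s.card ≤ k := by
      refine le_trans ?_ hdk
      rw [← (Finset.mem_piAntidiag.1 ha).1, Finset.card_eq_sum_ones]
      refine (Finset.sum_le_sum fun i hi => ?_).trans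
        (Finset.sum_le_sum_of_subset (Finset.subset_univ s))
      exact Nat.one_le_iff_ne_zero.2 (Finset.mem_filter.1 hi).2
    have hprod (f : Fin n → ℝ) (hf : ∀ i, a i = 0 → f i = 1) :
        ∏ i, f i = ∏ i : s, f i := by
      rw [Finset.prod_coe_sort s f]
      refine (Finset.prod_subset (Finset.subset_univ s) fun i _ hi => hf i ?_).symm
      simpa [hs] using hi
    rw [hprod (fun i => ∫ ω, Y i ω ^ a i ∂P) (fun i hi => by simp [hi])]
    have e (ω : Ω) : ∏ i, Y i ω ^ a i = ∏ i : s, Y i ω ^ a i :=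
      hprod (fun i => Y i ω ^ a i) (fun i hi => by simp [hi])
    simp_rw [e]
    exact (h s hcard).integral_fun_prod_comp (f := fun (i : s) (x : ℝ) => x ^ a i)
      (fun i => (hY i).aemeasurable) (fun i => by fun_prop)
  · intro a _
    refine Integrable.const_mul ?_ _
    refine Integrable.of_bound (by fun_prop) 1 ?_
    filter_upwards [ae_all_iff.2 hb] with ω hω
    rw [Real.norm_eq_abs, Finset.abs_prod]
    refine Finset.prod_le_one (fun _ _ => abs_nonneg _) fun i _ => ?_
    rw [abs_pow]
    exact pow_le_one₀ (abs_nonneg _) (hω i)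

namespace Admissible

variable {Ω : Type*} [MeasurableSpace Ω] {P : Measure Ω} [IsProbabilityMeasure P]
  {n k d : ℕ} {v : ℝ} {X : Fin n → Ω → ℝ}

theorem integrable (h : Admissible k v X P) (i : Fin n) : Integrable (X i) P := by
  have h1 : Integrable (fun ω => X i ω - ∫ ω', X i ω' ∂P) P :=
    Integrable.of_bound ((h.measurable i).sub_const _).aestronglyMeasurable 1 (h.bounded i)
  exact (h1.add (integrable_const (∫ ω', X i ω' ∂P))).congr (.of_forall fun ω => by simp)

theorem centeredNorm_eq (h : Admissible k v X P) (hdk : d ≤ k) (hd : Even d) :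
    centeredNorm d X P =
      (d.factorial * (∏ i, momentPoly d (fun j => centralMoment (X i) j P)).coeff d) ^
        (1 / (d : ℝ)) := by
  have hmean : ∫ ω, totalSum X ω ∂P = ∑ i, ∫ ω, X i ω ∂P :=
    integral_finsetSum _ fun i _ => h.integrable i
  have hind : KWiseIndep k (fun i ω => X i ω - ∫ ω', X i ω' ∂P) P := fun s hs =>
    (h.indep s hs).comp (fun (i : s) x => x - ∫ ω', X i ω' ∂P) fun i => by fun_prop
  have := integral_sum_pow_eq hdk (fun i => (h.measurable i).sub_const _) h.bounded hind
  rw [centeredNorm, momentNorm, hmean]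
  congr 1
  refine Eq.trans ?_ this
  refine integral_congr_ae (.of_forall fun ω => ?_)
  simp [hd.pow_abs, totalSum]

theorem abs_centralMoment_le (h : Admissible k v X P) (i : Fin n) {j : ℕ} (hj : 2 ≤ j) :
    |centralMoment (X i) j P| ≤ variance (X i) P := by
  rw [variance_eq_integral (h.measurable i).aemeasurable, ← Real.norm_eq_abs]
  have hint : Integrable (fun ω => (X i ω - ∫ ω', X i ω' ∂P) ^ 2) P := by
    have := h.measurable i
    refine Integrable.of_bound (by fun_prop) 1 ?_
    filter_upwards [h.bounded i] with ω hω
    rw [norm_pow]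
    exact pow_le_one₀ (norm_nonneg _) hω
  refine norm_integral_le_of_norm_le hint ?_
  filter_upwards [h.bounded i] with ω hω
  simp only [Pi.pow_apply, Pi.sub_apply, norm_pow, Real.norm_eq_abs]
  rw [← sq_abs (X i ω - _)]
  exact pow_le_pow_of_le_one (abs_nonneg _) hω hj

theorem centeredNorm_le (h : Admissible k v X P) (hdk : d ≤ k) (hd : Even d) (hd0 : d ≠ 0)
    (hn : 0 < n) (hv : 0 < v)
    (hnd : (d : ℝ) ≤ 2 * n ∨ (d : ℝ) / n ≤ Real.log (d / (n * v))) :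
    centeredNorm d X P ≤ Real.exp 21 * momentBound n v d := by
  have hval := h.centeredNorm_eq hdk hd
  have hb (t : ℝ) (ht : 0 < t) := abs_factorial_mul_coeff_le hd0
    (m := fun i j => centralMoment (X i) j P) (v := fun i => variance (X i) P)
    (fun i => by simp [centralMoment]) (fun i => by simp [centralMoment_one])
    (fun i => variance_nonneg _ _) (fun i j hj => h.abs_centralMoment_le i hj) ht h.variance_le
  rw [hval]
  refine ((le_abs_self _).trans (Real.abs_rpow_le_abs_rpow _ _)).trans
    (rpow_le_momentBound hn hd0 hv hnd (abs_nonneg _) hb)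

end Admissible

/-! ### Realizing prescribed laws and attaining the maximum -/

/-- Families with arbitrary prescribed laws are realized by the coordinates of a product space. -/
theorem exists_kwiseIndep_map_eq {n : ℕ} (k : ℕ) (μ : Fin n → Measure ℝ)
    [∀ i, IsProbabilityMeasure (μ i)] :
    ∃ (Ω : Type u) (_ : MeasurableSpace Ω) (P : Measure Ω) (_ : IsProbabilityMeasure P)
      (X : Fin n → Ω → ℝ),
      (∀ i, Measurable (X i)) ∧ KWiseIndep k X P ∧ ∀ i, P.map (X i) = μ i := by
  have hup : Measurable (ULift.up : ℝ → ULift.{u} ℝ) := measurable_up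
  have hdown : Measurable (ULift.down : ULift.{u} ℝ → ℝ) := measurable_down
  have hp (i : Fin n) : IsProbabilityMeasure ((μ i).map (ULift.up : ℝ → ULift.{u} ℝ)) :=
    Measure.isProbabilityMeasure_map hup.aemeasurable
  refine ⟨Fin n → ULift.{u} ℝ, inferInstance, Measure.pi fun i => (μ i).map ULift.up,
    inferInstance, fun i ω => (ω i).down, fun i => hdown.comp (measurable_pi_apply i),
    fun s _ => ?_, fun i => ?_⟩
  · exact (iIndepFun_pi (X := fun _ => ULift.down) fun i => hdown.aemeasurable).precomp
      Subtype.val_injective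
  · beta_reduce
    rw [show (fun ω : Fin n → ULift.{u} ℝ => (ω i).down) = ULift.down ∘ Function.eval i from rfl,
      ← Measure.map_map hdown (measurable_pi_apply i), (measurePreserving_eval _ i).map_eq,
      Measure.map_map hdown hup]
    exact Measure.map_id

theorem admissible_of_map_eq {Ω : Type*} [MeasurableSpace Ω] {P : Measure Ω}
    [IsProbabilityMeasure P] {n k : ℕ} {v : ℝ} {X : Fin n → Ω → ℝ} {μ : Fin n → Measure ℝ}
    (hX : ∀ i, Measurable (X i)) (hind : KWiseIndep k X P) (hmap : ∀ i, P.map (X i) = μ i)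
    (hb : ∀ i, ∀ᵐ x ∂μ i, |x| ≤ 1) (hmean : ∀ i, ∫ x, x ∂μ i = 0)
    (hvar : ∑ i, ∫ x, x ^ 2 ∂μ i ≤ n * v) :
    Admissible k v X P ∧ ∀ i j, centralMoment (X i) j P = ∫ x, x ^ j ∂μ i := by
  have hmom (i : Fin n) (j : ℕ) : ∫ ω, X i ω ^ j ∂P = ∫ x, x ^ j ∂μ i := by
    rw [← hmap i, integral_map (hX i).aemeasurable (by fun_prop)]
  have hm0 (i : Fin n) : ∫ ω, X i ω ∂P = 0 := by simpa [hmean] using hmom i 1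
  refine ⟨⟨hX, hind, fun i => ?_, ?_⟩, fun i j => ?_⟩
  · simp only [hm0, sub_zero]
    refine ae_of_ae_map (hX i).aemeasurable (p := fun x : ℝ => |x| ≤ 1) ?_
    rw [hmap]; exact hb i
  · simp_rw [variance_eq_integral (hX _).aemeasurable, hm0, sub_zero, hmom]
    exact hvar
  · simp [centralMoment, hm0, hmom]

/-- The maximum exists: the set of tuples of laws on the compact interval `[-1, 1]` is compact
for weak convergence, and both the constraints and the moment of the sum are continuous functions
of the moments of these laws. -/
theorem exists_isGreatest_normValues {n k d : ℕ} (hdk : d ≤ k) (hd : Even d) {v : ℝ}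
    (hv : 0 ≤ v) : ∃ m, IsGreatest (normValues.{u} n k v d) m := by
  let K := Set.Icc (-1 : ℝ) 1
  let mom (μ : ProbabilityMeasure K) (j : ℕ) : ℝ := ∫ x, (x : ℝ) ^ j ∂(μ : Measure K)
  have hmom (j : ℕ) : Continuous fun μ : ProbabilityMeasure K => mom μ j :=
    ProbabilityMeasure.continuous_integral_continuousMap
      (⟨fun x : K => (x : ℝ) ^ j, by fun_prop⟩ : C(K, ℝ))
  let F (μ : Fin n → ProbabilityMeasure K) : ℝ :=
    (d.factorial * (∏ i, momentPoly d (mom (μ i))).coeff d) ^ (1 / (d : ℝ))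
  have hF : Continuous F := by
    refine Continuous.rpow_const ?_ fun _ => Or.inr (by positivity)
    simp_rw [factorial_mul_coeff_prod_momentPoly]
    exact continuous_finsetSum _ fun a _ => continuous_const.mul
      (continuous_finsetProd _ fun i _ => (hmom _).comp (continuous_apply i))
  let A : Set (Fin n → ProbabilityMeasure K) :=
    {μ | (∀ i, mom (μ i) 1 = 0) ∧ ∑ i, mom (μ i) 2 ≤ n * v}
  have hA : IsClosed A := by
    refine IsClosed.inter (s₁ := {μ : Fin n → ProbabilityMeasure K | ∀ i, mom (μ i) 1 = 0})
      (s₂ := {μ : Fin n → ProbabilityMeasure K | ∑ i, mom (μ i) 2 ≤ n * v}) ?_ ?_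
    · simp only [Set.ofPred_forall]
      exact isClosed_iInter fun i =>
        isClosed_eq ((hmom 1).comp (continuous_apply i)) continuous_const
    · exact isClosed_le (continuous_finsetSum _ fun i _ => (hmom 2).comp (continuous_apply i))
        continuous_const
  have hne : A.Nonempty := by
    refine ⟨fun _ => ⟨Measure.dirac ⟨0, by norm_num, by norm_num⟩, inferInstance⟩, fun i => ?_, ?_⟩
    · simp [mom]
    · simp only [mom, ProbabilityMeasure.coe_mk, integral_dirac]
      simp only [ne_eq, OfNat.ofNat_ne_zero, not_false_eq_true, zero_pow, Finset.sum_const_zero]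
      positivity
  obtain ⟨μ, hμA, hμ⟩ := hA.isCompact.exists_isMaxOn hne hF.continuousOn
  refine ⟨F μ, ?_, ?_⟩
  · let ν (i : Fin n) : Measure ℝ := (μ i : Measure K).map Subtype.val
    have hp (i : Fin n) : IsProbabilityMeasure (ν i) :=
      Measure.isProbabilityMeasure_map measurable_subtype_coe.aemeasurable
    have hν (i : Fin n) (j : ℕ) : ∫ x, x ^ j ∂ν i = mom (μ i) j :=
      integral_map measurable_subtype_coe.aemeasurable (by fun_prop)
    obtain ⟨Ω, _, P, _, X, hX, hind, hmap⟩ := exists_kwiseIndep_map_eq.{u} k ν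
    obtain ⟨hadm, hcm⟩ := admissible_of_map_eq (v := v) hX hind hmap
      (fun i => (ae_map_iff measurable_subtype_coe.aemeasurable
        (measurableSet_le (by fun_prop) (by fun_prop))).2 (.of_forall fun x => abs_le.2 x.2))
      (fun i => by simpa [hμA.1] using hν i 1) (by simpa only [hν] using hμA.2)
    refine ⟨Ω, _, P, inferInstance, X, hadm, ?_⟩
    rw [hadm.centeredNorm_eq hdk hd]
    simp only [hcm, hν, F]
  · rintro r ⟨Ω, _, P, _, X, hadm, rfl⟩
    let g (i : Fin n) (ω : Ω) : K :=
      Set.projIcc (-1) 1 (by norm_num) (X i ω - ∫ ω', X i ω' ∂P)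
    have hg (i : Fin n) : Measurable (g i) :=
      continuous_projIcc.measurable.comp ((hadm.measurable i).sub_const _)
    let ν (i : Fin n) : ProbabilityMeasure K :=
      ⟨P.map (g i), Measure.isProbabilityMeasure_map (hg i).aemeasurable⟩
    have hν (i : Fin n) (j : ℕ) : mom (ν i) j = centralMoment (X i) j P := by
      refine (integral_map (hg i).aemeasurable (by fun_prop)).trans (integral_congr_ae ?_)
      filter_upwards [hadm.bounded i] with ω hω
      simp only [g, Set.projIcc_of_mem _ (abs_le.1 hω), Pi.pow_apply, Pi.sub_apply]
    have hmem : ν ∈ A := by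
      refine ⟨fun i => by simp [hν, centralMoment_one], ?_⟩
      simp only [hν, centralMoment_two_eq_variance (hadm.measurable _).aemeasurable]
      exact hadm.variance_le
    have := hμ hmem
    rw [hadm.centeredNorm_eq hdk hd]
    simpa only [Set.mem_ofPred_eq, F, funext (hν _)] using this

/-! ### The extremal family -/

/-- The symmetric law on `{-1, 0, 1}` of variance `v`. -/
noncomputable def threePointLaw (v : ℝ) : Measure ℝ :=
  ENNReal.ofReal (v / 2) • Measure.dirac 1 + ENNReal.ofReal (v / 2) • Measure.dirac (-1) +
    ENNReal.ofReal (1 - v) • Measure.dirac 0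

theorem isProbabilityMeasure_threePointLaw {v : ℝ} (hv : 0 ≤ v) (hv1 : v ≤ 1) :
    IsProbabilityMeasure (threePointLaw v) := by
  constructor
  simp only [threePointLaw, Measure.add_apply, Measure.smul_apply, measure_univ, smul_eq_mul,
    mul_one]
  rw [← ENNReal.ofReal_add (by positivity) (by positivity),
    ← ENNReal.ofReal_add (by positivity) (by linarith)]
  simp

theorem integral_threePointLaw {v : ℝ} (hv : 0 ≤ v) (hv1 : v ≤ 1) (j : ℕ) :
    ∫ x, x ^ j ∂threePointLaw v = threePointMoment v j := by
  have hi (a c : ℝ) : Integrable (fun x : ℝ => x ^ j) (ENNReal.ofReal c • Measure.dirac a) :=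
    (integrable_dirac (by simp)).smul_measure ENNReal.ofReal_ne_top
  rw [threePointLaw, integral_add_measure ((hi _ _).add_measure (hi _ _)) (hi _ _),
    integral_add_measure (hi _ _) (hi _ _)]
  simp only [integral_smul_measure, integral_dirac, smul_eq_mul,
    ENNReal.toReal_ofReal (show 0 ≤ v / 2 by positivity), ENNReal.toReal_ofReal (sub_nonneg.2 hv1),
    threePointMoment]
  rcases eq_or_ne j 0 with rfl | hj
  · norm_num
  · rcases Nat.even_or_odd j with hj' | hj'
    · simp [hj, hj', hj'.neg_one_pow]
    · simp [hj, Nat.not_even_iff_odd.2 hj', hj'.neg_one_pow]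

theorem ae_threePointLaw (v : ℝ) : ∀ᵐ x ∂threePointLaw v, |x| ≤ 1 := by
  simp only [threePointLaw, ae_add_measure_iff]
  refine ⟨⟨?_, ?_⟩, ?_⟩ <;> refine Measure.ae_smul_measure ?_ _ <;> simp [ae_dirac_eq]

theorem bernoulliDiffLaw_eq (p : unitInterval) :
    bernoulliDiffLaw p = threePointLaw (2 * (p * (1 - p))) := by
  have hp0 : (0 : ℝ) ≤ p := p.2.1
  have hp1 : (0 : ℝ) ≤ 1 - p := sub_nonneg.2 p.2.2
  have hm : Measurable fun b : ℝ × ℝ => b.1 - b.2 := by fun_prop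
  have hB : bernoulliMeasure (1 : ℝ) 0 p = ENNReal.ofReal p • Measure.dirac 1 +
      ENNReal.ofReal (1 - p) • Measure.dirac 0 := by
    ext s hs
    simp only [bernoulliMeasure_def, Measure.add_apply, Measure.smul_apply, smul_eq_mul,
      ENNReal.smul_def]
    congr 3
    · exact (Real.toNNReal_of_nonneg hp0).symm
    · exact (Real.toNNReal_of_nonneg hp1).symm
  have hdiag : ENNReal.ofReal (1 - 2 * (p * (1 - p))) =
      ENNReal.ofReal p * ENNReal.ofReal p + ENNReal.ofReal (1 - p) * ENNReal.ofReal (1 - p) := by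
    rw [← ENNReal.ofReal_mul hp0, ← ENNReal.ofReal_mul hp1,
      ← ENNReal.ofReal_add (by positivity) (by positivity)]
    congr 1
    ring
  have hoff : ENNReal.ofReal (2 * (p * (1 - p)) / 2) =
      ENNReal.ofReal p * ENNReal.ofReal (1 - p) := by
    rw [← ENNReal.ofReal_mul hp0]
    congr 1
    ring
  rw [bernoulliDiffLaw, hB, threePointLaw, hdiag, hoff]
  ext s hs
  simp only [Measure.prod_add, Measure.add_prod, Measure.prod_smul_left, Measure.prod_smul_right,
    Measure.dirac_prod_dirac, Measure.map_add _ _ hm, Measure.map_smul, Measure.map_dirac' hm,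
    Measure.add_apply, Measure.smul_apply, smul_eq_mul, sub_self, sub_zero, zero_sub]
  ring

/-- A `k`-wise independent family of variables with the symmetric law on `{-1, 0, 1}` is
admissible, and the moment of its sum is explicit. -/
theorem admissible_of_map_eq_threePointLaw {Ω : Type*} [MeasurableSpace Ω] {P : Measure Ω}
    [IsProbabilityMeasure P] {n k d : ℕ} (hdk : d ≤ k) (hd : Even d) {v : ℝ} (hv : 0 ≤ v)
    (hv1 : v ≤ 1) {X : Fin n → Ω → ℝ} (hX : ∀ i, Measurable (X i)) (hind : KWiseIndep k X P)
    (hmap : ∀ i, P.map (X i) = threePointLaw v) :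
    Admissible k v X P ∧ centeredNorm d X P = threePointSumMoment n v d ^ (1 / (d : ℝ)) := by
  obtain ⟨hadm, hcm⟩ := admissible_of_map_eq (v := v) hX hind hmap (fun _ => ae_threePointLaw v)
    (fun i => by simpa [threePointMoment] using integral_threePointLaw hv hv1 1)
    (by simp [integral_threePointLaw hv hv1, threePointMoment])
  refine ⟨hadm, ?_⟩
  rw [hadm.centeredNorm_eq hdk hd, threePointSumMoment]
  simp only [hcm, integral_threePointLaw hv hv1, Finset.prod_const, Finset.card_fin]

/-! ### Two-sided bounds for the maximum -/

theorem theorem1 :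
    ∃ c C : ℝ, 0 < c ∧ 0 < C ∧
      ∀ (n k d : ℕ) (σ : ℝ), 0 < n → 2 ≤ k → 0 < d → Even d → d ≤ k → 0 < σ → σ ^ 2 ≤ 1 →
        ((d : ℝ) ≤ 2 * n ∨ (d : ℝ) / n ≤ Real.log (d / (n * σ ^ 2))) →
        ∃ m : ℝ, IsGreatest (normValues.{u} n k (σ ^ 2) d) m ∧
          c * momentBound n (σ ^ 2) d ≤ m ∧ m ≤ C * momentBound n (σ ^ 2) d ∧
          (σ ^ 2 ≤ 1 / 2 →
            ∃ p : unitInterval, (p : ℝ) = 1 / 2 * (1 - √(1 - 2 * σ ^ 2)) ∧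
              (∃ (Ω : Type u) (_ : MeasurableSpace Ω) (P : Measure Ω)
                (_ : IsProbabilityMeasure P) (X : Fin n → Ω → ℝ),
                (∀ i, Measurable (X i)) ∧ KWiseIndep k X P ∧
                  ∀ i, P.map (X i) = bernoulliDiffLaw p) ∧
              ∀ (Ω : Type u) (_ : MeasurableSpace Ω) (P : Measure Ω)
                (_ : IsProbabilityMeasure P) (X : Fin n → Ω → ℝ),
                (∀ i, Measurable (X i)) → KWiseIndep k X P →
                (∀ i, P.map (X i) = bernoulliDiffLaw p) →
                Admissible k (σ ^ 2) X P ∧ c * m ≤ centeredNorm d X P) := by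
  have hc : 0 < Real.exp (-1) / 4 / Real.exp 21 := by positivity
  refine ⟨Real.exp (-1) / 4 / Real.exp 21, Real.exp 21, hc, Real.exp_pos _, ?_⟩
  intro n k d σ hn _ hd0 hd hdk hσ hσ1 hnd
  have hd0' : d ≠ 0 := hd0.ne'
  have hv : 0 < σ ^ 2 := by positivity
  obtain ⟨m, hm⟩ := exists_isGreatest_normValues.{u} (n := n) hdk hd hv.le
  have hlow := momentBound_le_rpow hn hd0' hd hv hnd
  have hM := momentBound_nonneg n hv.le d
  have hup : m ≤ Real.exp 21 * momentBound n (σ ^ 2) d := by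
    obtain ⟨Ω, _, P, _, X, hadm, rfl⟩ := hm.1
    exact hadm.centeredNorm_le hdk hd hd0' hn hv hnd
  refine ⟨m, hm, ?_, hup, fun hσ2 => ?_⟩
  · have := isProbabilityMeasure_threePointLaw hv.le hσ1
    obtain ⟨Ω, _, P, _, X, hX, hind, hmap⟩ :=
      exists_kwiseIndep_map_eq.{u} k (fun _ : Fin n => threePointLaw (σ ^ 2))
    obtain ⟨hadm, hval⟩ := admissible_of_map_eq_threePointLaw hdk hd hv.le hσ1 hX hind hmap
    have h1 : centeredNorm d X P ≤ m := hm.2 ⟨Ω, _, P, inferInstance, X, hadm, rfl⟩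
    exact (mul_le_mul_of_nonneg_right (div_le_self (by positivity)
      (Real.one_le_exp (by norm_num))) hM).trans ((hval ▸ hlow).trans h1)
  · have hs0 : 0 ≤ √(1 - 2 * σ ^ 2) := Real.sqrt_nonneg _
    have hs1 : √(1 - 2 * σ ^ 2) ≤ 1 := Real.sqrt_le_one.2 (by linarith)
    have hsq : √(1 - 2 * σ ^ 2) ^ 2 = 1 - 2 * σ ^ 2 := Real.sq_sqrt (by linarith)
    refine ⟨⟨1 / 2 * (1 - √(1 - 2 * σ ^ 2)), by linarith, by linarith⟩, rfl, ?_⟩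
    have hlaw : bernoulliDiffLaw ⟨1 / 2 * (1 - √(1 - 2 * σ ^ 2)), by linarith, by linarith⟩ =
        threePointLaw (σ ^ 2) := by
      rw [bernoulliDiffLaw_eq]
      congr 1
      linear_combination (-1 / 2 : ℝ) * hsq
    rw [hlaw]
    have := isProbabilityMeasure_threePointLaw hv.le hσ1
    refine ⟨exists_kwiseIndep_map_eq.{u} k (fun _ : Fin n => threePointLaw (σ ^ 2)), ?_⟩
    intro Ω _ P _ X hX hind hmap
    obtain ⟨hadm, hval⟩ := admissible_of_map_eq_threePointLaw hdk hd hv.le hσ1 hX hind hmap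
    refine ⟨hadm, ?_⟩
    rw [hval]
    refine le_trans ?_ hlow
    rw [div_mul_eq_mul_div, mul_div_assoc]
    gcongr
    rw [div_le_iff₀ (Real.exp_pos _), mul_comm]
    exact hup
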